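/- A group is called $\mathbb{Z}$-linear if it is isomorphic to a subgroup of $GL_m(\mathbb{Z})$ for some natural number $m$. Theorem. Let $K$ be a finitely generated free abelian group with a presentation $\langle S_K \mid R_K\rangle$, let $n\ge 0$, let $w_1,\dots,w_n$ be words in $S_K$ (equivalently, elements of $K$), and let $$G=\langle S_K, t_1,\dots,t_n \mid R_K,\ [t_i,w_i]=1\ (1\le i\le n)\rangle$$ be the multiple HNN-extension with base $K$ and stable letters $t_1,\dots,t_n$, where $t_i$ centralizes the cyclic subgroup $\langle w_i\rangle$ of $K$ (i.e. both associated subgroups of $t_i$ are $\langle w_i\rangle$, with the identity isomorphism). Then $G$ is $\mathbb{Z}$-linear. -/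

import Mathlib

open scoped commutatorElement

/-- A group `G` is linear over the commutative ring `A` (`A`-linear) if it admits a faithful
representation `G → GL_m(A)` for some natural number `m`. -/
def IsLinearOver (A : Type*) [CommRing A] (G : Type*) [Group G] : Prop :=
  ∃ (m : ℕ) (ρ : G →* Matrix.GeneralLinearGroup (Fin m) A), Function.Injective ρ

/-- The relators of `⟨S, t₁, …, tₙ | R, [tᵢ, wᵢ] = 1⟩`: the old relators `R`, read as words in the
enlarged alphabet `S ⊔ {t₁, …, tₙ}`, and the commutators of `tᵢ` with the words `wᵢ` in `S`. -/
def roseRelators {S : Type*} (R : Set (FreeGroup S)) {n : ℕ} (w : Fin n → FreeGroup S) :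
    Set (FreeGroup (S ⊕ Fin n)) :=
  FreeGroup.map Sum.inl '' R ∪
    Set.range fun i : Fin n =>
      ⁅(FreeGroup.of (Sum.inr i) : FreeGroup (S ⊕ Fin n)), FreeGroup.map Sum.inl (w i)⁆

/-- The group `⟨S, t₁, …, tₙ | R, [tᵢ, wᵢ] = 1⟩`, i.e. the multiple HNN-extension with base
`⟨S | R⟩` and stable letters `tᵢ`, where the two associated subgroups of `tᵢ` are both the cyclic
group generated by `wᵢ` and `tᵢ` acts on it as the identity. -/
abbrev RoseGroup {S : Type*} (R : Set (FreeGroup S)) {n : ℕ} (w : Fin n → FreeGroup S) : Type _ :=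
  PresentedGroup (roseRelators R w)

/-! Every element of G is a product fk with k in K and f in the image of a free group whose
generators, the conjugates of the tᵢ, are indexed by the cosets in K/⟨wᵢ⟩; K permutes them. Let K
translate functions on a disjoint union of quotients of K, and let each free generator act as a
product of two reflections f ↦ f - 2f(y)κ(y,·), where κ is K-invariant, 1 on the diagonal and ≤ -1
off it. Ping-pong, as for a universal Coxeter group, shows that no nontrivial f fixes the constant
function 1 (`eq_one_of_lift_kernelReflection_apply_one`), while K does fix it. A free orbit of K
then detects k. Choosing κ quadratic along K keeps all of this inside a finitely generated lattice W
(`exists_kernel_of_quotients`), which yields integral matrices. -/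

/-- A function `f : A → ℤ` is of finite type if its translates lie in a finitely generated
translation-invariant group of functions. -/
def IsFiniteType {A : Type*} [Group A] (f : A → ℤ) : Prop :=
  ∃ N : Submodule ℤ (A → ℤ), N.FG ∧ f ∈ N ∧ ∀ h ∈ N, ∀ a : A, (fun b => h (a * b)) ∈ N

namespace IsFiniteType

theorem const {A : Type*} [Group A] (c : ℤ) : IsFiniteType (fun _ : A => c) := by
  refine ⟨Submodule.span ℤ {fun _ => c}, Submodule.fg_span (Set.finite_singleton _),
    Submodule.mem_span_singleton_self _, fun h hh a => ?_⟩
  obtain ⟨m, rfl⟩ := Submodule.mem_span_singleton.1 hh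
  exact Submodule.mem_span_singleton.2 ⟨m, rfl⟩

theorem add {A : Type*} [Group A] {f g : A → ℤ} (hf : IsFiniteType f) (hg : IsFiniteType g) :
    IsFiniteType (fun a => f a + g a) := by
  obtain ⟨N, hN, hfN, iN⟩ := hf
  obtain ⟨P, hP, hgP, iP⟩ := hg
  refine ⟨N ⊔ P, hN.sup hP, Submodule.add_mem_sup hfN hgP, fun h hh a => ?_⟩
  obtain ⟨x, hx, y, hy, rfl⟩ := Submodule.mem_sup.1 hh
  exact Submodule.add_mem_sup (iN x hx a) (iP y hy a)

theorem sum {A ι : Type*} [Group A] (s : Finset ι) {f : ι → A → ℤ}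
    (hf : ∀ i, IsFiniteType (f i)) : IsFiniteType (fun a => ∑ i ∈ s, f i a) := by
  classical
  induction s using Finset.induction_on with
  | empty => simpa using const 0
  | insert i s hi ih =>
    simp only [Finset.sum_insert hi]
    exact (hf i).add ih

theorem comp {A B : Type*} [Group A] [Group B] {f : B → ℤ} (hf : IsFiniteType f) (q : A →* B) :
    IsFiniteType (fun a => f (q a)) := by
  obtain ⟨N, hN, hfN, iN⟩ := hf
  refine ⟨N.map (LinearMap.funLeft ℤ ℤ q), hN.map _, ⟨f, hfN, rfl⟩, ?_⟩
  rintro _ ⟨x, hx, rfl⟩ a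
  exact ⟨_, iN x hx (q a), by ext b; simp [LinearMap.funLeft_apply]⟩

theorem of_finite {A : Type*} [Group A] [Finite A] (f : A → ℤ) : IsFiniteType f :=
  ⟨⊤, Module.Finite.fg_top, trivial, fun _ _ _ => trivial⟩

theorem toAdd_sq : IsFiniteType (fun a : Multiplicative ℤ => a.toAdd ^ 2) := by
  refine ⟨Submodule.span ℤ (Set.range fun i : Fin 3 => fun a : Multiplicative ℤ =>
    a.toAdd ^ (i : ℕ)), Submodule.fg_span (Set.finite_range _),
    Submodule.subset_span ⟨2, rfl⟩, fun h hh a => ?_⟩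
  rw [Submodule.mem_span_range_iff_exists_fun] at hh ⊢
  obtain ⟨c, rfl⟩ := hh
  refine ⟨![c 0 + c 1 * a.toAdd + c 2 * a.toAdd ^ 2, c 1 + 2 * c 2 * a.toAdd, c 2], ?_⟩
  ext b
  simp [Fin.sum_univ_three]
  ring

end IsFiniteType

/-- Sum of squares of the free coordinates, plus indicators of nontriviality on the cyclic torsion
factors; quotients K/⟨wᵢ⟩ can have torsion. -/
theorem exists_isFiniteType_separating (A : Type*) [CommGroup A] [Group.FG A] :
    ∃ ψ : A → ℤ, IsFiniteType ψ ∧ ψ 1 = 0 ∧ ∀ a, a ≠ 1 → 1 ≤ ψ a := by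
  classical
  obtain ⟨ι, j, _, _, p, hp, e, ⟨E⟩⟩ := CommGroup.equiv_free_prod_prod_multiplicative_zmod A
  have : ∀ i, NeZero (p i ^ e i) := fun i => ⟨pow_ne_zero _ (hp i).ne_zero⟩
  let q₁ (k : j) : A →* Multiplicative ℤ :=
    ((Pi.evalMonoidHom _ k).comp (MonoidHom.fst _ _)).comp E.toMonoidHom
  let q₂ (i : ι) : A →* Multiplicative (ZMod (p i ^ e i)) :=
    ((Pi.evalMonoidHom _ i).comp (MonoidHom.snd _ _)).comp E.toMonoidHom
  have hfin : ∀ i, Finite (Multiplicative (ZMod (p i ^ e i))) := fun i =>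
    inferInstanceAs (Finite (ZMod _))
  refine ⟨fun a => ∑ k, (q₁ k a).toAdd ^ 2 + ∑ i, if q₂ i a = 1 then 0 else 1,
    (IsFiniteType.sum _ fun k => IsFiniteType.toAdd_sq.comp (q₁ k)).add
      (IsFiniteType.sum _ fun i =>
        (IsFiniteType.of_finite fun x => if x = 1 then 0 else 1).comp (q₂ i)), by simp, ?_⟩
  intro a ha
  have h₁ : ∀ k ∈ Finset.univ, 0 ≤ (q₁ k a).toAdd ^ 2 := fun k _ => sq_nonneg _
  have h₂ : ∀ i ∈ Finset.univ, (0 : ℤ) ≤ if q₂ i a = 1 then 0 else 1 := fun i _ => by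
    split_ifs <;> simp
  have H₁ := Finset.sum_nonneg h₁
  have H₂ := Finset.sum_nonneg h₂
  by_contra! hlt
  have z₁ := (Finset.sum_eq_zero_iff_of_nonneg h₁).1 (by linarith)
  have z₂ := (Finset.sum_eq_zero_iff_of_nonneg h₂).1 (by linarith)
  refine ha (E.injective ?_)
  rw [map_one]
  refine Prod.ext (funext fun k => ?_) (funext fun i => ?_)
  · exact toAdd_eq_zero.1 (pow_eq_zero_iff two_ne_zero |>.1 (z₁ k (Finset.mem_univ _)))
  · change q₂ i a = 1
    by_contra h
    exact one_ne_zero ((if_neg h).symm.trans (z₂ i (Finset.mem_univ _)))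

/-! ### Reflections and ping-pong -/

section Reflections

variable {Y : Type*} (κ : Y → Y → ℤ) (hκ : ∀ y, κ y y = 1)

/-- The reflection `f ↦ f - 2 f(y) κ(y, ·)` of the group of integral functions on `Y`. -/
def kernelReflection (y : Y) : (Y → ℤ) ≃ₗ[ℤ] (Y → ℤ) :=
  Module.reflection (x := κ y) (f := (2 : ℤ) • LinearMap.proj y) (by simp [hκ])

theorem kernelReflection_apply (y : Y) (f : Y → ℤ) (z : Y) :
    kernelReflection κ hκ y f z = f z - 2 * f y * κ y z := by
  simp [kernelReflection, Module.reflection_apply]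

theorem kernelReflection_mem {W : Submodule ℤ (Y → ℤ)} {y : Y} (hy : κ y ∈ W) {f : Y → ℤ}
    (hf : f ∈ W) : kernelReflection κ hκ y f ∈ W := by
  rw [kernelReflection, Module.reflection_apply]
  exact W.sub_mem hf (W.smul_mem _ hy)

/-- The functions whose only negative value is at `y` and is minimal in absolute value. -/
def negativeAt (y : Y) : Set (Y → ℤ) := {f | f y < 0 ∧ ∀ z, z ≠ y → -f y ≤ f z}

variable {κ}

/-- Here f y ≥ -f y' > 0: reflecting at y flips this value and adds at least 2 f y everywhere else,
which outweighs the negative value at y'. -/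
theorem kernelReflection_mem_negativeAt (hneg : ∀ y z, y ≠ z → κ y z ≤ -1) {y y' : Y}
    (hy : y ≠ y') {f : Y → ℤ} (hf : f ∈ negativeAt y') :
    kernelReflection κ hκ y f ∈ negativeAt y := by
  obtain ⟨h0, h1⟩ := hf
  have hfy := h1 y hy
  simp only [negativeAt, Set.mem_ofPred_eq, kernelReflection_apply, hκ]
  refine ⟨by linarith, fun z hz => ?_⟩
  have hk := hneg y z hz.symm
  have : f y * 1 ≤ f y * -κ y z := mul_le_mul_of_nonneg_left (by linarith) (by linarith)
  rcases eq_or_ne z y' with rfl | hz'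
  · linarith
  · linarith [h1 z hz']

theorem kernelReflection_one_mem_negativeAt (hneg : ∀ y z, y ≠ z → κ y z ≤ -1) (y : Y) :
    kernelReflection κ hκ y 1 ∈ negativeAt y := by
  simp only [negativeAt, Set.mem_ofPred_eq, kernelReflection_apply, hκ, Pi.one_apply]
  exact ⟨by norm_num, fun z hz => by linarith [hneg y z hz.symm]⟩

variable {X : Type*} (e : X → Bool → Y)

/-- Each letter is two reflections at distinct points, inversion swapping them. Adjacent letters put
the same reflection side by side only if they are mutually inverse, so a reduced word never repeats
a reflection consecutively. -/
theorem lift_kernelReflection_mk_mem_negativeAt (hneg : ∀ y z, y ≠ z → κ y z ≤ -1)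
    (he : Function.Injective2 e) : ∀ (x : X × Bool) (L : List (X × Bool)),
    FreeGroup.IsReduced (x :: L) →
    FreeGroup.lift (fun x => kernelReflection κ hκ (e x true) * kernelReflection κ hκ (e x false))
      (FreeGroup.mk (x :: L)) 1 ∈ negativeAt (e x.1 x.2) := by
  have step : ∀ (x : X × Bool) (f : Y → ℤ),
      FreeGroup.lift (fun x => kernelReflection κ hκ (e x true) *
        kernelReflection κ hκ (e x false)) (FreeGroup.mk [x]) f =
      kernelReflection κ hκ (e x.1 x.2) (kernelReflection κ hκ (e x.1 !x.2) f) := by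
    rintro ⟨x, b⟩ f
    cases b <;> simp [kernelReflection, mul_inv_rev, Module.reflection_inv]
  have hne : ∀ x : X × Bool, e x.1 x.2 ≠ e x.1 !x.2 := fun x h => by simpa using (he h).2
  intro x L
  induction L generalizing x with
  | nil =>
    intro _
    rw [step]
    exact kernelReflection_mem_negativeAt hκ hneg (hne x)
      (kernelReflection_one_mem_negativeAt hκ hneg _)
  | cons y L ih =>
    intro h
    rw [FreeGroup.isReduced_cons_cons] at h
    have : FreeGroup.mk (x :: y :: L) = FreeGroup.mk [x] * FreeGroup.mk (y :: L) := by
      simp [FreeGroup.mul_mk]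
    rw [this, map_mul, LinearEquiv.mul_apply, step]
    refine kernelReflection_mem_negativeAt hκ hneg (hne x)
      (kernelReflection_mem_negativeAt hκ hneg (fun hxy => ?_) (ih y h.2))
    obtain ⟨h₁, h₂⟩ := he hxy
    have := h.1 h₁
    simp_all

theorem eq_one_of_lift_kernelReflection_apply_one (hneg : ∀ y z, y ≠ z → κ y z ≤ -1)
    (he : Function.Injective2 e) (g : FreeGroup X)
    (hg : FreeGroup.lift (fun x => kernelReflection κ hκ (e x true) *
      kernelReflection κ hκ (e x false)) g 1 = 1) : g = 1 := by
  classical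
  rw [← FreeGroup.mk_toWord (x := g)] at hg
  rcases hL : g.toWord with _ | ⟨x, L⟩
  · exact FreeGroup.toWord_eq_nil_iff.1 hL
  · have hr : FreeGroup.IsReduced (x :: L) := hL ▸ FreeGroup.isReduced_toWord
    have := (lift_kernelReflection_mk_mem_negativeAt hκ e hneg he x L hr).1
    rw [← hL, hg] at this
    simp at this

/-- The action of a group on the integral functions on a set on which it acts. -/
def translation (K Y : Type*) [Group K] [MulAction K Y] : K →* ((Y → ℤ) ≃ₗ[ℤ] (Y → ℤ)) where
  toFun k := LinearEquiv.funCongrLeft ℤ ℤ (MulAction.toPerm k⁻¹)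
  map_one' := by ext; simp [LinearEquiv.funCongrLeft_apply, LinearMap.funLeft_apply]
  map_mul' a b := by
    ext; simp [LinearEquiv.funCongrLeft_apply, LinearMap.funLeft_apply, mul_smul]

theorem translation_apply {K : Type*} [Group K] [MulAction K Y] (k : K) (f : Y → ℤ) (y : Y) :
    translation K Y k f y = f (k⁻¹ • y) := rfl

theorem translation_mul_kernelReflection {K : Type*} [Group K] [MulAction K Y]
    (hinv : ∀ (k : K) y z, κ (k • y) (k • z) = κ y z) (k : K) (y : Y) :
    translation K Y k * kernelReflection κ hκ y =
      kernelReflection κ hκ (k • y) * translation K Y k := by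
  refine LinearEquiv.ext fun f => funext fun z => ?_
  simp only [LinearEquiv.mul_apply, translation_apply, kernelReflection_apply, inv_smul_smul]
  rw [← hinv k y, smul_inv_smul]

end Reflections

/-! ### The lattice, the kernel and the decomposition of G -/

theorem isLinearOver_int_of_representation {G M : Type*} [Group G] [AddCommGroup M]
    [IsAddTorsionFree M] (ρ : G →* (M ≃ₗ[ℤ] M)) (W : Submodule ℤ M) (hW : W.FG)
    (hinv : ∀ g, ∀ m ∈ W, ρ g m ∈ W) (hinj : ∀ g, (∀ m ∈ W, ρ g m = m) → g = 1) :
    IsLinearOver ℤ G := by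
  have : Module.Finite ℤ W := Module.Finite.iff_fg.2 hW
  have : Module.Free ℤ W := inferInstance
  let σ : G →* Module.End ℤ W :=
    { toFun := fun g => (ρ g).toLinearMap.restrict (hinv g)
      map_one' := by ext; simp
      map_mul' := fun a b => by ext; simp }
  let b := Module.finBasis ℤ W
  let τ : G →* Matrix (Fin (Module.finrank ℤ W)) (Fin (Module.finrank ℤ W)) ℤ :=
    ((LinearMap.toMatrixAlgEquiv b).toMulEquiv.toMonoidHom).comp σ
  refine ⟨_, τ.toHomUnits, (injective_iff_map_eq_one _).2 fun g hg => hinj g fun m hm => ?_⟩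
  have h1 : τ g = 1 := congrArg Units.val hg
  have h2 : σ g = 1 := (LinearMap.toMatrixAlgEquiv b).injective (by rw [map_one]; exact h1)
  exact congrArg Subtype.val (LinearMap.congr_fun h2 ⟨m, hm⟩)

theorem exists_kernel_of_quotients {K J : Type*} [CommGroup K] [Group.FG K] [Finite J]
    (H : J → Subgroup K) :
    ∃ (κ : (Σ j, K ⧸ H j) → (Σ j, K ⧸ H j) → ℤ) (W : Submodule ℤ ((Σ j, K ⧸ H j) → ℤ)),
      (∀ y, κ y y = 1) ∧ (∀ y z, y ≠ z → κ y z ≤ -1) ∧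
      (∀ (k : K) y z, κ (k • y) (k • z) = κ y z) ∧ W.FG ∧ 1 ∈ W ∧ (∀ y, κ y ∈ W) ∧
      ∀ (k : K), ∀ f ∈ W, translation K _ k f ∈ W := by
  classical
  choose ψ hψ hψ1 hψpos using fun j => exists_isFiniteType_separating (K ⧸ H j)
  choose N₁ hN₁ hψN₁ iN₁ using hψ
  choose N₂ hN₂ h1N₂ iN₂ using fun j => IsFiniteType.const (A := K ⧸ H j) 1
  let N : ∀ j, Submodule ℤ ((K ⧸ H j) → ℤ) := fun j => N₁ j ⊔ N₂ j
  have iN : ∀ j, ∀ h ∈ N j, ∀ a : K ⧸ H j, (fun b => h (a * b)) ∈ N j := by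
    intro j h hh a
    obtain ⟨x, hx, y, hy, rfl⟩ := Submodule.mem_sup.1 hh
    exact Submodule.add_mem_sup (iN₁ j x hx a) (iN₂ j y hy a)
  have hψN : ∀ j, ψ j ∈ N j := fun j => Submodule.mem_sup_left (hψN₁ j)
  have h1N : ∀ j, (fun _ => 1) ∈ N j := fun j => Submodule.mem_sup_right (h1N₂ j)
  let C := LinearEquiv.piCurry ℤ (κ := fun j => K ⧸ H j) fun _ _ => ℤ
  let W : Submodule ℤ ((Σ j, K ⧸ H j) → ℤ) := (Submodule.pi Set.univ N).map C.symm.toLinearMap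
  have memW : ∀ f, f ∈ W ↔ ∀ j, (fun a => f ⟨j, a⟩) ∈ N j := by
    intro f
    constructor
    · rintro ⟨g, hg, rfl⟩ j
      exact hg j trivial
    · intro h
      exact ⟨C f, fun j _ => h j, C.symm_apply_apply f⟩
  -- On one orbit, 1 - 2ψ(a⁻¹b): each row is a translate of a finite-type function, hence lies in W,
  -- and ψ ≥ 1 off the identity gives ≤ -1.
  let κ : (Σ j, K ⧸ H j) → (Σ j, K ⧸ H j) → ℤ := fun y z =>
    if h : y.1 = z.1 then 1 - 2 * ψ z.1 ((h ▸ y.2)⁻¹ * z.2) else -1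
  have κ_same : ∀ j (a b : K ⧸ H j), κ ⟨j, a⟩ ⟨j, b⟩ = 1 - 2 * ψ j (a⁻¹ * b) := by
    intro j a b
    simp [κ]
  have κ_ne : ∀ i j (a : K ⧸ H i) (b : K ⧸ H j), i ≠ j → κ ⟨i, a⟩ ⟨j, b⟩ = -1 := by
    intro i j a b h
    simp [κ, h]
  have smul_eq : ∀ j (k : K) (a : K ⧸ H j), k • a = (k : K ⧸ H j) * a := by
    rintro j k ⟨a⟩
    rfl
  refine ⟨κ, W, ?_, ?_, ?_, ?_, ?_, ?_, ?_⟩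
  · rintro ⟨j, a⟩
    simp [κ_same, hψ1]
  · rintro ⟨i, a⟩ ⟨j, b⟩ hne
    by_cases h : i = j
    · subst h
      have := hψpos i (a⁻¹ * b) fun h => hne (by rw [inv_mul_eq_one.1 h])
      rw [κ_same]
      linarith
    · rw [κ_ne _ _ _ _ h]
  · rintro k ⟨i, a⟩ ⟨j, b⟩
    by_cases h : i = j
    · subst h
      rw [Sigma.smul_mk, Sigma.smul_mk, κ_same, κ_same, smul_eq, smul_eq]
      congr 3
      group
    · rw [Sigma.smul_mk, Sigma.smul_mk, κ_ne _ _ _ _ h, κ_ne _ _ _ _ h]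
  · cases nonempty_fintype J
    exact (Submodule.fg_pi fun j => (hN₁ j).sup (hN₂ j)).map _
  · exact (memW _).2 fun j => h1N j
  · rintro ⟨i, a⟩
    refine (memW _).2 fun j => ?_
    by_cases h : i = j
    · subst h
      have := (N i).sub_mem (h1N i) ((N i).smul_mem 2 (iN i _ (hψN i) a⁻¹))
      convert this using 2 with b
      simp [κ_same]
    · have := (N j).neg_mem (h1N j)
      convert this using 2 with b
      simp [κ_ne _ _ _ _ h]
  · intro k f hf
    refine (memW _).2 fun j => ?_
    have := iN j _ ((memW f).1 hf j) (k⁻¹ : K)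
    convert this using 2 with b
    rw [translation_apply, Sigma.smul_mk, smul_eq]

/-- Conjugation by K permutes the images of the free generators, so the products φ(f)ι(k) already
form a subgroup. -/
theorem exists_eq_mul_of_conj_transversal {G K X : Type*} [Group G] [Group K] [MulAction K X]
    (ι : K →* G) (φ : FreeGroup X →* G)
    (hφ : ∀ k x, ι k * φ (FreeGroup.of x) * (ι k)⁻¹ = φ (FreeGroup.of (k • x)))
    {s : Set G} (hs : Subgroup.closure s = ⊤) (h : ∀ g ∈ s, g ∈ ι.range ⊔ φ.range) (g : G) :
    ∃ f k, g = φ f * ι k := by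
  have conj : ∀ k f, ι k * φ f = φ (FreeGroup.map (k • ·) f) * ι k := by
    intro k f
    rw [← mul_inv_eq_iff_eq_mul]
    refine DFunLike.congr_fun (f := (MulAut.conj (ι k)).toMonoidHom.comp φ)
      (g := φ.comp (FreeGroup.map (k • ·))) (FreeGroup.ext_hom _ _ fun x => ?_) f
    simpa using hφ k x
  let P : Subgroup G :=
    { carrier := {g | ∃ f k, g = φ f * ι k}
      one_mem' := ⟨1, 1, by simp⟩
      mul_mem' := by
        rintro _ _ ⟨f, k, rfl⟩ ⟨f', k', rfl⟩
        refine ⟨f * FreeGroup.map (k • ·) f', k * k', ?_⟩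
        rw [map_mul, map_mul, mul_assoc, ← mul_assoc (ι k), conj]
        simp only [mul_assoc]
      inv_mem' := by
        rintro _ ⟨f, k, rfl⟩
        exact ⟨_, k⁻¹, by rw [mul_inv_rev, ← map_inv, ← map_inv, conj]⟩ }
  have hP : ι.range ⊔ φ.range ≤ P := by
    refine sup_le ?_ ?_
    · rintro _ ⟨k, rfl⟩
      exact ⟨1, k, by simp⟩
    · rintro _ ⟨f, rfl⟩
      exact ⟨f, 1, by simp⟩
  have : Subgroup.closure s ≤ P := (Subgroup.closure_le _).2 fun g hg => hP (h g hg)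
  rw [hs] at this
  exact this (Subgroup.mem_top g)

/-! ### The faithful representation -/

theorem mainTheorem3 {K : Type*} [CommGroup K] [Group.FG K] [Module.Free ℤ (Additive K)]
    {S : Type*} (R : Set (FreeGroup S)) (presK : PresentedGroup R ≃* K)
    (n : ℕ) (w : Fin n → FreeGroup S) :
    IsLinearOver ℤ (RoseGroup R w) := by
  let u : Fin n → K := fun i => presK (PresentedGroup.mk R (w i))
  -- Two copies of each K/⟨uᵢ⟩ carry the two reflections of a generator; the `none` copy K/⊥ is the
  -- free orbit that makes K act faithfully.
  let H : Option (Fin n × Bool) → Subgroup K := fun j =>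
    j.elim ⊥ fun p => Subgroup.zpowers (u p.1)
  obtain ⟨κ, W, hκ, hneg, hinv, hWfg, h1W, hκW, hKW⟩ := exists_kernel_of_quotients H
  let e : (Σ i, K ⧸ Subgroup.zpowers (u i)) → Bool → Σ j, K ⧸ H j := fun x b =>
    ⟨some (x.1, b), x.2⟩
  have he : Function.Injective2 e := by
    rintro ⟨i, a⟩ ⟨j, a'⟩ b b' h
    cases h
    exact ⟨rfl, rfl⟩
  let T : (Σ i, K ⧸ Subgroup.zpowers (u i)) → (((Σ j, K ⧸ H j) → ℤ) ≃ₗ[ℤ] ((Σ j, K ⧸ H j) → ℤ)) :=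
    fun x => kernelReflection κ hκ (e x true) * kernelReflection κ hκ (e x false)
  let τ := translation K (Σ j, K ⧸ H j)
  have hT : ∀ k x, τ k * T x = T (k • x) * τ k := by
    intro k x
    simp only [T, τ]
    rw [← mul_assoc, translation_mul_kernelReflection hκ hinv, mul_assoc,
      translation_mul_kernelReflection hκ hinv, ← mul_assoc]
    rfl
  have mk_mem : ∀ i, u i • (⟨i, 1⟩ : Σ i, K ⧸ Subgroup.zpowers (u i)) = ⟨i, 1⟩ := by
    intro i
    rw [Sigma.smul_mk]
    congr 1
    change ((u i * 1 : K) : K ⧸ Subgroup.zpowers (u i)) = 1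
    rw [mul_one]
    exact (QuotientGroup.eq_one_iff (u i)).2 (Subgroup.mem_zpowers _)
  let gen : S ⊕ Fin n → (((Σ j, K ⧸ H j) → ℤ) ≃ₗ[ℤ] ((Σ j, K ⧸ H j) → ℤ)) :=
    Sum.elim (fun s => τ (presK (PresentedGroup.of s))) fun i => T ⟨i, 1⟩
  have hgen : ∀ r, FreeGroup.lift gen (FreeGroup.map Sum.inl r) =
      τ (presK (PresentedGroup.mk R r)) := by
    refine DFunLike.congr_fun (f := (FreeGroup.lift gen).comp (FreeGroup.map Sum.inl))
      (g := (τ.comp presK.toMonoidHom).comp (PresentedGroup.mk R))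
      (FreeGroup.ext_hom _ _ fun s => ?_)
    simp [gen, PresentedGroup.of]
  let ρ : RoseGroup R w →* _ := PresentedGroup.toGroup (rels := roseRelators R w) (f := gen) (by
    rintro _ (⟨r, hr, rfl⟩ | ⟨i, rfl⟩)
    · rw [hgen, PresentedGroup.one_of_mem hr, map_one, map_one]
    · rw [map_commutatorElement, hgen, commutatorElement_eq_one_iff_mul_comm,
        FreeGroup.lift_apply_of]
      refine ((hT (u i) ⟨i, 1⟩).trans ?_).symm
      rw [mk_mem]
      rfl)
  let ι₀ : PresentedGroup R →* RoseGroup R w :=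
    PresentedGroup.toGroup (f := fun s => PresentedGroup.of (Sum.inl s)) (by
      intro r hr
      have : FreeGroup.lift (fun s => (PresentedGroup.of (Sum.inl s) : RoseGroup R w)) =
          (PresentedGroup.mk (roseRelators R w)).comp (FreeGroup.map Sum.inl) :=
        FreeGroup.ext_hom _ _ fun s => by simp [PresentedGroup.of]
      rw [this]
      exact PresentedGroup.one_of_mem (Or.inl ⟨r, hr, rfl⟩))
  have hι₀ : ∀ r, ι₀ (PresentedGroup.mk R r) =
      PresentedGroup.mk (roseRelators R w) (FreeGroup.map Sum.inl r) := by
    refine DFunLike.congr_fun (f := ι₀.comp (PresentedGroup.mk R))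
      (g := (PresentedGroup.mk (roseRelators R w)).comp (FreeGroup.map Sum.inl))
      (FreeGroup.ext_hom _ _ fun s => ?_)
    exact FreeGroup.lift_apply_of (f := fun s => (PresentedGroup.of (Sum.inl s) : RoseGroup R w))
  let ι : K →* RoseGroup R w := ι₀.comp presK.symm.toMonoidHom
  have hρι : ∀ k, ρ (ι k) = τ k := by
    intro k
    obtain ⟨r, hr⟩ := PresentedGroup.mk_surjective R (presK.symm k)
    have : ι k = PresentedGroup.mk (roseRelators R w) (FreeGroup.map Sum.inl r) := by
      rw [← hι₀, hr]
      rfl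
    rw [this]
    refine (hgen r).trans ?_
    rw [hr, MulEquiv.apply_symm_apply]
  let t : Fin n → RoseGroup R w := fun i => PresentedGroup.of (Sum.inr i)
  have hρt : ∀ i, ρ (t i) = T ⟨i, 1⟩ := fun i => PresentedGroup.toGroup.of _
  have htu : ∀ i, Commute (ι (u i)) (t i) := by
    intro i
    have h₁ : ι (u i) = PresentedGroup.mk (roseRelators R w) (FreeGroup.map Sum.inl (w i)) := by
      rw [← hι₀]
      simp [ι, u]
    have h₂ : PresentedGroup.mk (roseRelators R w)
        ⁅FreeGroup.of (Sum.inr i), FreeGroup.map Sum.inl (w i)⁆ = 1 :=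
      PresentedGroup.one_of_mem (Or.inr ⟨i, rfl⟩)
    rw [map_commutatorElement, commutatorElement_eq_one_iff_mul_comm, ← h₁] at h₂
    exact h₂.symm
  -- The conjugate of tᵢ depends only on the coset of k, so the representatives chosen in `φ` do not
  -- matter.
  have hconj : ∀ i (k l : K), (k : K ⧸ Subgroup.zpowers (u i)) = l →
      ι k * t i * (ι k)⁻¹ = ι l * t i * (ι l)⁻¹ := by
    intro i k l h
    obtain ⟨m, hm⟩ := Subgroup.mem_zpowers_iff.1 (QuotientGroup.eq.1 h)
    obtain rfl : l = k * u i ^ m := by rw [hm, mul_inv_cancel_left]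
    have := (htu i).zpow_left m
    rw [map_mul, map_zpow, mul_inv_rev, mul_assoc (ι k) (ι (u i) ^ m), this.eq]
    group
  let φ : FreeGroup (Σ i, K ⧸ Subgroup.zpowers (u i)) →* RoseGroup R w :=
    FreeGroup.lift fun x => ι x.2.out * t x.1 * (ι x.2.out)⁻¹
  have hφof : ∀ i (k : K), φ (FreeGroup.of ⟨i, k⟩) = ι k * t i * (ι k)⁻¹ := by
    intro i k
    simp only [φ, FreeGroup.lift_apply_of]
    exact hconj i _ _ (QuotientGroup.out_eq' _)
  have hρφ : ∀ f, ρ (φ f) = FreeGroup.lift T f := by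
    refine DFunLike.congr_fun (f := ρ.comp φ) (FreeGroup.ext_hom _ _ ?_)
    rintro ⟨i, ⟨k⟩⟩
    rw [MonoidHom.comp_apply]
    refine (congrArg ρ (hφof i k)).trans ?_
    rw [map_mul, map_mul, map_inv, hρι, hρt, hT, mul_inv_cancel_right, FreeGroup.lift_apply_of,
      Sigma.smul_mk]
    congr 2
    exact congrArg (QuotientGroup.mk (s := Subgroup.zpowers (u i))) (mul_one k)
  have decomp : ∀ g, ∃ f k, g = φ f * ι k := by
    refine exists_eq_mul_of_conj_transversal ι φ ?_
      (PresentedGroup.closure_range_of (roseRelators R w)) ?_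
    · rintro k ⟨i, ⟨l⟩⟩
      refine (congrArg (fun g => ι k * g * (ι k)⁻¹) (hφof i l)).trans
        (Eq.trans ?_ (hφof i (k * l)).symm)
      rw [map_mul]
      group
    · rintro _ ⟨s | i, rfl⟩
      · refine Subgroup.mem_sup_left ⟨presK (PresentedGroup.of s), ?_⟩
        simp only [ι, MonoidHom.comp_apply, MulEquiv.toMonoidHom_eq_coe, MonoidHom.coe_coe,
          MulEquiv.symm_apply_apply]
        exact PresentedGroup.toGroup.of (rels := R) _
      · refine Subgroup.mem_sup_right ⟨FreeGroup.of ⟨i, (1 : K)⟩, ?_⟩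
        rw [hφof]
        simp [t]
  have hinvW : ∀ g, ∀ f ∈ W, ρ g f ∈ W := by
    have key : ∀ f : FreeGroup _, ∀ m ∈ W, FreeGroup.lift T f m ∈ W := by
      intro f
      induction f using FreeGroup.induction_on with
      | C1 => simp
      | of x =>
        intro m hm
        rw [FreeGroup.lift_apply_of]
        exact kernelReflection_mem κ hκ (hκW _) (kernelReflection_mem κ hκ (hκW _) hm)
      | inv_of x _ =>
        intro m hm
        rw [map_inv, FreeGroup.lift_apply_of]
        simp only [T, mul_inv_rev, kernelReflection, Module.reflection_inv]
        exact kernelReflection_mem κ hκ (hκW _) (kernelReflection_mem κ hκ (hκW _) hm)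
      | mul a b ha hb =>
        intro m hm
        rw [map_mul]
        exact ha _ (hb _ hm)
    intro g m hm
    obtain ⟨f, k, rfl⟩ := decomp g
    rw [map_mul, hρφ, hρι]
    exact key f _ (hKW k m hm)
  refine isLinearOver_int_of_representation ρ W hWfg hinvW fun g hg => ?_
  obtain ⟨f, k, rfl⟩ := decomp g
  -- Translations fix the constant 1, so this equation involves f alone.
  have h1 := hg 1 h1W
  rw [map_mul, hρφ, hρι] at h1
  obtain rfl : f = 1 := eq_one_of_lift_kernelReflection_apply_one hκ e hneg he f h1
  let y : Σ j, K ⧸ H j := ⟨none, (1 : K)⟩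
  have h2 := congrFun (hg (κ y) (hκW y)) y
  rw [map_one, one_mul, hρι, hκ] at h2
  -- `κ y` takes the value 1 only at y, so k must fix a point of the free orbit.
  have h3 : y = k⁻¹ • y := by
    by_contra hne
    have := hneg _ _ hne
    rw [← translation_apply k (κ y)] at this
    linarith
  have h4 : ((1 : K) : K ⧸ (⊥ : Subgroup K)) = (k⁻¹ * 1 : K) := 
    eq_of_heq (Sigma.mk.inj h3).2
  have h5 := QuotientGroup.eq.1 h4
  obtain rfl : k = 1 := by simpa using h5
  simp
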